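/- Let $(\mathcal A,\otimes,k)$ be a bicomplete abelian category with a closed symmetric monoidal structure, and let $\mathcal P$ be a symmetric operad in $\mathcal A$ that is reduced: $\mathcal P_0=0$ and the unit $k\to\mathcal P_1$ is an isomorphism. For a $\mathcal P$-algebra $B$ write $\mu^B$ for its structure maps $\mathcal P_n\otimes B^{\otimes n}\to B$. An *action* of a $\mathcal P$-algebra $B$ on a $\mathcal P$-algebra $X$ is a morphism $\rho:\mathcal P\circ(B|X):=\bigoplus_n \mathcal P_n\otimes_{\Sigma_n}\big((X\oplus B)^{\otimes n}/B^{\otimes n}\big)\to X$ of $\mathcal A$ which restricts to $\mu^X$ on $\mathcal P(X)$ and is associative, i.e. compatible with the composition of $\mathcal P$, when an operation is evaluated on $X\oplus B$ by $(\rho,\mu^B)$. Every $B$ acts on itself, by $\mathcal P\circ(B|B)\hookrightarrow\mathcal P(B\oplus B)\to\mathcal P(B)\to B$. A *precrossed module* is an action of $V_0$ on $V_1$ with a morphism of $\mathcal P$-algebras $d:V_1\to V_0$ that is equivariant for this action and the action of $V_0$ on itself; a morphism is a pair of $\mathcal P$-algebra morphisms $V_1\to V_1'$, $V_0\to V_0'$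 compatible with the actions and with $d$, $d'$. It is a *crossed module* if it satisfies the Peiffer identity: for all $n\ge i\ge 2$, on $\mathcal P_n\otimes V_1^{\otimes i}\otimes V_0^{\otimes n-i}$, $$\rho=\rho\circ(\mathrm{Id}\otimes \mathrm{Id}_{V_1}\otimes d^{\otimes i-1}\otimes \mathrm{Id}).$$ $\mathrm{XMod}(\mathcal P\text{-alg})$ is the full subcategory of crossed modules. Let $Ch(\mathcal A)$ be the symmetric monoidal category of $\mathbb Z$-graded chain complexes in $\mathcal A$ (Koszul signs), let $\mathcal P$ be seen as an operad in $Ch(\mathcal A)$ concentrated in degree $0$, and let $\mathcal P\text{-alg}_{\le1}(Ch(\mathcal A))$ be the category of $\mathcal P$-algebras in $Ch(\mathcal A)$ whose complex is concentrated in degrees $0$ and $1$. **Proposition.** For every crossed module of $\mathcal P$-algebras $(V_0\overset{\rho}{\curvearrowright}V_1,\ d:V_1\to V_0)$, the following maps $\mu_n^k:(\mathcal P_n\otimes_{\Sigma_n} V^{\otimes n})_k\to V_k$ define a $\mathcal P$-algebra structure on the complex $V=(\cdots\to0\to V_1\overset{d}{\to}V_0\to0)$ in $Ch(\mathcal A)$,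 and it is the only $\mathcal P$-algebra structure on $V$ with these components: * $\mu_n^0:\mathcal P_n\otimes_{\Sigma_n} V_0^{\otimes n}\to V_0$ is the structure map $\mu^{V_0}$ of $V_0$; * $\mu_n^1:(\mathcal P_n\otimes_{\Sigma_n}V^{\otimes n})_1\to V_1$ is given by the $V_0$-$\mathcal P$-module structure of $V_1$, that is, by $\rho$ on tensors with exactly one factor in $V_1$ and the others in $V_0$; * $\mu_n^k=0$ for $k\ge2$. This construction is a functor $\mathrm{XMod}(\mathcal P\text{-alg})\to\mathcal P\text{-alg}_{\le1}(Ch(\mathcal A))$: it sends a crossed module to $V$ with this structure, and a morphism $(V_1\to V_1',\,V_0\to V_0')$ to the morphism of complexes with these components in degrees $1$ and $0$. -/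

import Mathlib

open CategoryTheory MonoidalCategory Limits

universe v u

namespace OpdX

noncomputable section

/-! ### Finite tensor products in a symmetric monoidal category -/

section Tensor

variable {C : Type u} [Category.{v} C] [MonoidalCategory C]

/-- The tensor product `F 0 ⊗ F 1 ⊗ ⋯ ⊗ F (n - 1)`, bracketed to the left. -/
@[reducible] def tens : {n : ℕ} → (Fin n → C) → C
  | 0, _ => 𝟙_ C
  | n + 1, F => tens (fun i : Fin n => F i.castSucc) ⊗ F (Fin.last n)

/-- The tensor power `X ^ ⊗ n`. -/
abbrev tpow (X : C) (n : ℕ) : C := tens (fun _ : Fin n => X)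

/-- The tensor product of a family of morphisms. -/
def tensMap : {n : ℕ} → {F G : Fin n → C} → (∀ i, F i ⟶ G i) → (tens F ⟶ tens G)
  | 0, _, _, _ => 𝟙 (𝟙_ C)
  | n + 1, _, _, f => tensMap (fun i : Fin n => f i.castSucc) ⊗ₘ f (Fin.last n)

theorem tensMap_id : {n : ℕ} → (F : Fin n → C) → tensMap (fun i => 𝟙 (F i)) = 𝟙 (tens F)
  | 0, _ => rfl
  | n + 1, F => by
      have h := tensMap_id (fun i : Fin n => F i.castSucc)
      simp only [tensMap, h]
      exact id_tensorHom_id _ _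

theorem tensMap_comp : {n : ℕ} → {F G H : Fin n → C} → (f : ∀ i, F i ⟶ G i) →
    (g : ∀ i, G i ⟶ H i) → tensMap (fun i => f i ≫ g i) = tensMap f ≫ tensMap g
  | 0, _, _, _, _, _ => (Category.comp_id (𝟙 (𝟙_ C))).symm
  | n + 1, _, _, _, f, g => by
      have h := tensMap_comp (fun i : Fin n => f i.castSucc) (fun i : Fin n => g i.castSucc)
      simp only [tensMap, h]
      exact (tensorHom_comp_tensorHom _ _ _ _).symm

/-- The first `a` positions, the middle `m` positions and the last `b` positions
among `a + m + b`. -/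
abbrev posL (a m b : ℕ) (i : Fin a) : Fin (a + m + b) := Fin.castAdd b (Fin.castAdd m i)
/-- See `posL`. -/
abbrev posM (a m b : ℕ) (i : Fin m) : Fin (a + m + b) := Fin.castAdd b (Fin.natAdd a i)
/-- See `posL`. -/
abbrev posR (a m b : ℕ) (i : Fin b) : Fin (a + m + b) := Fin.natAdd (a + m) i

/-- The canonical isomorphism cutting a tensor product of `a + b` factors into two blocks. -/
def tensSplit (a : ℕ) : (b : ℕ) → (F : Fin (a + b) → C) →
    (tens F ≅ tens (fun i : Fin a => F (Fin.castAdd b i)) ⊗ tens (fun j : Fin b => F (Fin.natAdd a j)))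
  | 0, F => (ρ_ (tens F)).symm
  | b + 1, F =>
      whiskerRightIso (tensSplit a b (fun i => F i.castSucc)) (F (Fin.last (a + b))) ≪≫ α_ _ _ _

/-- The canonical isomorphism cutting a tensor product of `a + m + b` factors into three blocks. -/
def tensSplit₃ (a m b : ℕ) (F : Fin (a + m + b) → C) :
    tens F ≅ (tens (fun i => F (posL a m b i)) ⊗ tens (fun i => F (posM a m b i))) ⊗
      tens (fun i => F (posR a m b i)) :=
  tensSplit (a + m) b F ≪≫
    whiskerRightIso (tensSplit a m (fun i => F (Fin.castAdd b i))) _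

variable [SymmetricCategory C]

/-- Move the `i`-th factor of a tensor product to the last place, by the symmetry. -/
def tensExtract : {n : ℕ} → (F : Fin (n + 1) → C) → (i : Fin (n + 1)) →
    (tens F ⟶ tens (fun j => F (i.succAbove j)) ⊗ F i)
  | 0, F, i => (𝟙_ C) ◁ eqToHom (congrArg F (Subsingleton.elim (α := Fin 1) _ _))
  | n + 1, F, i =>
      if h : i = Fin.last (n + 1) then
        tensMap (fun j => eqToHom (congrArg F (by rw [h, Fin.succAbove_last]))) ⊗ₘ
          eqToHom (congrArg F h.symm)
      else
        tensExtract (fun j : Fin (n + 1) => F j.castSucc) (i.castPred h) ▷ F (Fin.last (n + 1)) ≫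
          (α_ _ _ _).hom ≫ _ ◁ (β_ _ _).hom ≫ (α_ _ _ _).inv ≫
          ((tensMap (fun j : Fin n => eqToHom (congrArg F (by
              rw [← Fin.castSucc_succAbove_castSucc, Fin.castSucc_castPred]))) ⊗ₘ
            eqToHom (congrArg F (Fin.succAbove_ne_last_last h).symm)) ⊗ₘ
            eqToHom (congrArg F (Fin.castSucc_castPred i h)))

/-- The permutation `τ` of the first `n` positions with
`(σ last).succAbove (τ j) = σ j.castSucc`. -/
def residual {n : ℕ} (σ : Equiv.Perm (Fin (n + 1))) : Equiv.Perm (Fin n) :=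
  (finSuccAboveEquiv (Fin.last n)).trans
    ((σ.subtypeEquiv (fun x => by simp)).trans (finSuccAboveEquiv (σ (Fin.last n))).symm)

theorem residual_spec {n : ℕ} (σ : Equiv.Perm (Fin (n + 1))) (j : Fin n) :
    (σ (Fin.last n)).succAbove (residual σ j) = σ j.castSucc := by
  have h : ((finSuccAboveEquiv (σ (Fin.last n)) (residual σ j) : Fin (n + 1))) = σ j.castSucc := by
    simp only [residual, Equiv.trans_apply, Equiv.apply_symm_apply]
    simp [finSuccAboveEquiv_apply]
  simpa only [finSuccAboveEquiv_apply] using h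

/-- The permutation of tensor factors `x₀ ⊗ ⋯ ⊗ xₙ₋₁ ↦ x_{σ 0} ⊗ ⋯ ⊗ x_{σ (n-1)}`, by the
symmetry. -/
def tensPerm : {n : ℕ} → (σ : Equiv.Perm (Fin n)) → (F : Fin n → C) →
    (tens F ⟶ tens (fun i => F (σ i)))
  | 0, _, _ => 𝟙 (𝟙_ C)
  | n + 1, σ, F =>
      tensExtract F (σ (Fin.last n)) ≫
        (tensPerm (residual σ) (fun j => F ((σ (Fin.last n)).succAbove j)) ≫
          tensMap (fun j => eqToHom (congrArg F (residual_spec σ j)))) ▷ _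

/-- Plug a morphism into a block of consecutive factors: from `f : Q ⊗ (middle block) ⟶ Y` and
morphisms on the remaining factors, the morphism `Q ⊗ (a + m + b factors) ⟶ (a + 1 + b factors)`
moving `Q` past the first `a` factors and applying `f` to it and the `m` middle ones. -/
def plug (a m b : ℕ) {F : Fin (a + m + b) → C} {G : Fin (a + 1 + b) → C} {Q : C}
    (l : ∀ i, F (posL a m b i) ⟶ G (posL a 1 b i))
    (f : Q ⊗ tens (fun i => F (posM a m b i)) ⟶ G (posM a 1 b 0))
    (r : ∀ i, F (posR a m b i) ⟶ G (posR a 1 b i)) :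
    Q ⊗ tens F ⟶ tens G :=
  Q ◁ (tensSplit₃ a m b F).hom ≫ (α_ _ _ _).inv ≫
    ((α_ _ _ _).inv ≫ (β_ _ _).hom ▷ _ ≫ (α_ _ _ _).hom ≫
      (tensMap l ⊗ₘ (f ≫ (λ_ _).inv))) ▷ _ ≫
    _ ◁ tensMap r ≫ (tensSplit₃ a 1 b G).inv

end Tensor

/-! ### Symmetric operads and their algebras -/

section Operad

/-- The embedding of the `a + b` outer positions among `a + m + b`. -/
def outer (a m b : ℕ) : Fin a ⊕ Fin b → Fin (a + m + b) :=
  Sum.elim (posL a m b) (posR a m b)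

/-- `ω` is the bijection of the positions of `p ∘ q` induced by a bijection `σ` of the positions of
`p` (matching the positions in which `q` is inserted) and a bijection `τ` of the positions
of `q`. -/
def IsGraft {a b m a' b' m' : ℕ} (σ : Fin (a + 1 + b) ≃ Fin (a' + 1 + b')) (τ : Fin m ≃ Fin m')
    (ω : Fin (a + m + b) ≃ Fin (a' + m' + b')) : Prop :=
  σ (posM a 1 b 0) = posM a' 1 b' 0 ∧
  (∀ j, ω (posM a m b j) = posM a' m' b' (τ j)) ∧
  ∀ x y, σ (outer a 1 b x) = outer a' 1 b' y → ω (outer a m b x) = outer a' m' b' y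

/-- A symmetric operad in a symmetric monoidal category, by partial compositions.
`act σ` relabels input `i` as input `σ i`; the right action of `σ` in the symmetric group is
`act σ⁻¹`. The morphism `comp a b m` is the partial composition inserting an operation of
arity `m` in the input number `a + 1` of an operation of arity `a + 1 + b`. -/
structure SymmOperad (C : Type u) [Category.{v} C] [MonoidalCategory C]
    [SymmetricCategory C] where
  /-- The object of operations of arity `n`. -/
  obj : ℕ → C
  /-- The action of bijections. -/
  act : ∀ {m n : ℕ}, (Fin m ≃ Fin n) → (obj m ⟶ obj n)
  /-- The identity operation. -/
  unit : 𝟙_ C ⟶ obj 1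
  /-- The partial compositions. -/
  comp : ∀ a b m : ℕ, obj (a + 1 + b) ⊗ obj m ⟶ obj (a + m + b)
  act_refl : ∀ n, act (Equiv.refl (Fin n)) = 𝟙 (obj n)
  act_trans : ∀ {l m n : ℕ} (σ : Fin l ≃ Fin m) (τ : Fin m ≃ Fin n),
    act (σ.trans τ) = act σ ≫ act τ
  act_comp : ∀ {a b m a' b' m' : ℕ} (σ : Fin (a + 1 + b) ≃ Fin (a' + 1 + b'))
    (τ : Fin m ≃ Fin m') (ω : Fin (a + m + b) ≃ Fin (a' + m' + b')), IsGraft σ τ ω →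
    (act σ ⊗ₘ act τ) ≫ comp a' b' m' = comp a b m ≫ act ω
  unit_comp : ∀ m, unit ▷ obj m ≫ comp 0 0 m = (λ_ _).hom ≫ act (finCongr (by omega))
  comp_unit : ∀ a b, obj (a + 1 + b) ◁ unit ≫ comp a b 1 = (ρ_ _).hom
  /-- Sequential associativity. -/
  comp_seq : ∀ a b c d m : ℕ,
    comp a b (c + 1 + d) ▷ obj m ≫
        act (finCongr (show a + (c + 1 + d) + b = (a + c) + 1 + (d + b) by omega)) ▷ obj m ≫
        comp (a + c) (d + b) m =
      (α_ _ _ _).hom ≫ obj (a + 1 + b) ◁ comp c d m ≫ comp a b (c + m + d) ≫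
        act (finCongr (show a + (c + m + d) + b = (a + c) + m + (d + b) by omega))
  /-- Parallel associativity. -/
  comp_par : ∀ a b c m n : ℕ,
    (act (finCongr (show a + 1 + b + 1 + c = a + 1 + (b + 1 + c) by omega)) ▷ obj m ≫
          comp a (b + 1 + c) m ≫
          act (finCongr (show a + m + (b + 1 + c) = (a + m + b) + 1 + c by omega))) ▷ obj n ≫
        comp (a + m + b) c n =
      (α_ _ _ _).hom ≫ _ ◁ (β_ _ _).hom ≫ (α_ _ _ _).inv ≫
        (comp (a + 1 + b) c n ≫
          act (finCongr (show a + 1 + b + n + c = a + 1 + (b + n + c) by omega))) ▷ obj m ≫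
        comp a (b + n + c) m ≫
        act (finCongr (show a + m + (b + n + c) = (a + m + b) + n + c by omega))

variable {C : Type u} [Category.{v} C] [MonoidalCategory C] [SymmetricCategory C]

/-- An operad is reduced if there is no operation of arity zero and the object of operations of
arity one is the tensor unit. -/
def SymmOperad.IsReduced (P : SymmOperad C) : Prop :=
  IsZero (P.obj 0) ∧ IsIso P.unit

/-- An algebra over the operad `P` in `C`. -/
structure Alg (P : SymmOperad C) where
  /-- The underlying object. -/
  X : C
  /-- The structure morphisms. -/
  op : ∀ n, P.obj n ⊗ tpow X n ⟶ X
  op_act : ∀ {n} (σ : Equiv.Perm (Fin n)),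
    P.act σ ▷ tpow X n ≫ op n = P.obj n ◁ tensPerm σ (fun _ => X) ≫ op n
  op_unit : P.unit ▷ tpow X 1 ≫ op 1 = (λ_ _).hom ≫ (λ_ X).hom
  op_comp : ∀ a b m,
    P.comp a b m ▷ tpow X (a + m + b) ≫ op (a + m + b) =
      (α_ _ _ _).hom ≫ P.obj (a + 1 + b) ◁ plug a m b (fun _ => 𝟙 X) (op m) (fun _ => 𝟙 X) ≫
        op (a + 1 + b)

namespace Alg

variable {P : SymmOperad C}

/-- A morphism of algebras over an operad. -/
@[ext]
structure Hom (A B : Alg P) where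
  /-- The underlying morphism. -/
  hom : A.X ⟶ B.X
  op_hom : ∀ n, A.op n ≫ hom = P.obj n ◁ tensMap (fun _ => hom) ≫ B.op n

instance : Category (Alg P) where
  Hom A B := Hom A B
  id A := ⟨𝟙 A.X, fun n => by simp [tensMap_id]⟩
  comp f g := ⟨f.hom ≫ g.hom, fun n => by
    rw [← Category.assoc, f.op_hom, Category.assoc, g.op_hom, tensMap_comp]; simp⟩

@[simp] theorem id_hom (A : Alg P) : Hom.hom (𝟙 A) = 𝟙 A.X := rfl

@[simp] theorem comp_hom {A B D : Alg P} (f : A ⟶ B) (g : B ⟶ D) :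
    Hom.hom (f ≫ g) = f.hom ≫ g.hom := rfl

end Alg

end Operad

/-! ### Internal actions and crossed modules -/

section Crossed

variable {C : Type u} [Category.{v} C] [Abelian C] [MonoidalCategory C] [SymmetricCategory C]
variable {P : SymmOperad C}

/-- From `ρ : P n ⊗ (X ⊕ B) ^ ⊗ n ⟶ X`, the morphism
`(ρ, μ_B) : P n ⊗ (X ⊕ B) ^ ⊗ n ⟶ X ⊕ B`. -/
def extendOp (B : Alg P) {X : C} {n : ℕ} (ρ : P.obj n ⊗ tpow (X ⊞ B.X) n ⟶ X) :
    P.obj n ⊗ tpow (X ⊞ B.X) n ⟶ X ⊞ B.X :=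
  biprod.lift ρ (P.obj n ◁ tensMap (fun _ => biprod.snd) ≫ B.op n)

/-- An internal action of `B` on `X`. A morphism from
`⨁ n, P n ⊗_{Σ n} ((X ⊕ B) ^ ⊗ n / B ^ ⊗ n)` to `X` is the same thing as a family of morphisms
`P n ⊗ (X ⊕ B) ^ ⊗ n ⟶ X` that are invariant under the symmetric groups (`ρ_act`) and vanish
on `P n ⊗ B ^ ⊗ n` (`ρ_base`). -/
structure Action (B X : Alg P) where
  /-- The components of the action. -/
  ρ : ∀ n, P.obj n ⊗ tpow (X.X ⊞ B.X) n ⟶ X.X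
  ρ_act : ∀ {n} (σ : Equiv.Perm (Fin n)),
    P.act σ ▷ tpow (X.X ⊞ B.X) n ≫ ρ n = P.obj n ◁ tensPerm σ (fun _ => X.X ⊞ B.X) ≫ ρ n
  ρ_base : ∀ n, P.obj n ◁ tensMap (fun _ : Fin n => (biprod.inr : B.X ⟶ X.X ⊞ B.X)) ≫ ρ n = 0
  /-- Compatibility with the structure map of `X`. -/
  ρ_compat : ∀ n,
    P.obj n ◁ tensMap (fun _ : Fin n => (biprod.inl : X.X ⟶ X.X ⊞ B.X)) ≫ ρ n = X.op n
  /-- Associativity of the action. -/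
  ρ_comp : ∀ a b m,
    P.comp a b m ▷ tpow (X.X ⊞ B.X) (a + m + b) ≫ ρ (a + m + b) =
      (α_ _ _ _).hom ≫
        P.obj (a + 1 + b) ◁ plug a m b (fun _ => 𝟙 _) (extendOp B (ρ m)) (fun _ => 𝟙 _) ≫
        ρ (a + 1 + b)

/-- The components of the natural action of an algebra `B` on itself. The first morphism is the
projection of `(B ⊕ B) ^ ⊗ n` onto the complement `(B ⊕ B) ^ ⊗ n / B ^ ⊗ n` of its second copy of
`B ^ ⊗ n`, followed by the inclusion. -/
def selfAction (B : Alg P) (n : ℕ) : P.obj n ⊗ tpow (B.X ⊞ B.X) n ⟶ B.X :=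
  P.obj n ◁ ((𝟙 _ - tensMap (fun _ : Fin n => (biprod.snd ≫ biprod.inr : B.X ⊞ B.X ⟶ B.X ⊞ B.X))) ≫
    tensMap (fun _ => biprod.desc (𝟙 B.X) (𝟙 B.X))) ≫ B.op n

/-- A precrossed module: an action of `base` on `top` and an equivariant morphism of algebras
`d : top ⟶ base`. -/
structure PreXMod (P : SymmOperad C) where
  /-- The algebra which acts. -/
  base : Alg P
  /-- The algebra which is acted upon. -/
  top : Alg P
  /-- The action. -/
  action : Action base top
  /-- The boundary morphism. -/
  d : top ⟶ base
  equivariant : ∀ n,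
    action.ρ n ≫ d.hom =
      P.obj n ◁ tensMap (fun _ => biprod.map d.hom (𝟙 base.X)) ≫ selfAction base n

namespace PreXMod

/-- A morphism of precrossed modules: a morphism of actions commuting with the boundaries. -/
@[ext]
structure Hom (M N : PreXMod P) where
  /-- The morphism between the algebras which act. -/
  base : M.base ⟶ N.base
  /-- The morphism between the algebras which are acted upon. -/
  top : M.top ⟶ N.top
  action : ∀ n, M.action.ρ n ≫ top.hom =
    P.obj n ◁ tensMap (fun _ => biprod.map top.hom base.hom) ≫ N.action.ρ n
  comm : M.d ≫ base = top ≫ N.d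

instance : Category (PreXMod P) where
  Hom M N := Hom M N
  id M := ⟨𝟙 _, 𝟙 _, fun n => by
    have h : biprod.map (Alg.Hom.hom (𝟙 M.top)) (Alg.Hom.hom (𝟙 M.base)) =
      𝟙 (M.top.X ⊞ M.base.X) := by
        apply biprod.hom_ext <;> simp
    simp only [h, tensMap_id]
    exact (Category.comp_id _).trans (by simp), by simp⟩
  comp f g := ⟨f.base ≫ g.base, f.top ≫ g.top, fun n => by
    have h : biprod.map (Alg.Hom.hom (f.top ≫ g.top)) (Alg.Hom.hom (f.base ≫ g.base)) =
      biprod.map f.top.hom f.base.hom ≫ biprod.map g.top.hom g.base.hom := by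
        apply biprod.hom_ext <;> simp
    have h' : Alg.Hom.hom (f.top ≫ g.top) = f.top.hom ≫ g.top.hom := rfl
    rw [h, h', ← Category.assoc, f.action, Category.assoc, g.action, tensMap_comp]
    simp, by rw [← Category.assoc, f.comm, Category.assoc, g.comm, Category.assoc]⟩

/-- The Peiffer identity: on `P n ⊗ (X ^ ⊗ i ⊗ B ^ ⊗ (n - i))`, with `i = 1 + j` and
`n = 1 + j + r`, the action does not change when `d` is applied to all copies of `X` but the
first one. -/
def Peiffer (M : PreXMod P) : Prop :=
  ∀ j r : ℕ,
    P.obj (1 + j + r) ◁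
        (((tensMap (fun _ : Fin 1 => (biprod.inl : M.top.X ⟶ M.top.X ⊞ M.base.X)) ⊗ₘ
            tensMap (fun _ : Fin j => (biprod.inl : M.top.X ⟶ M.top.X ⊞ M.base.X))) ⊗ₘ
            tensMap (fun _ : Fin r => (biprod.inr : M.base.X ⟶ M.top.X ⊞ M.base.X))) ≫
          (tensSplit₃ 1 j r (fun _ => M.top.X ⊞ M.base.X)).inv) ≫
        M.action.ρ (1 + j + r) =
      P.obj (1 + j + r) ◁
        (((tensMap (fun _ : Fin 1 => (biprod.inl : M.top.X ⟶ M.top.X ⊞ M.base.X)) ⊗ₘ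
            tensMap (fun _ : Fin j => (M.d.hom ≫ biprod.inr : M.top.X ⟶ M.top.X ⊞ M.base.X))) ⊗ₘ
            tensMap (fun _ : Fin r => (biprod.inr : M.base.X ⟶ M.top.X ⊞ M.base.X))) ≫
          (tensSplit₃ 1 j r (fun _ => M.top.X ⊞ M.base.X)).inv) ≫
        M.action.ρ (1 + j + r)

end PreXMod

/-- The category of crossed modules, a full subcategory of that of precrossed modules. -/
abbrev XMod (P : SymmOperad C) : Type _ :=
  ObjectProperty.FullSubcategory (fun M : PreXMod P => M.Peiffer)

end Crossed

/-! ### Algebras in chain complexes -/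

section DG

variable {C : Type u} [Category.{v} C] [Abelian C] [MonoidalCategory C] [SymmetricCategory C]

/-- The Koszul sign of the permutation `x₀ ⊗ ⋯ ⊗ xₙ₋₁ ↦ x_{σ 0} ⊗ ⋯ ⊗ x_{σ (n-1)}` of homogeneous
elements, with `xᵢ` of degree `w i`. -/
def koszulSign {n : ℕ} (σ : Equiv.Perm (Fin n)) (w : Fin n → ℤ) : ℤˣ :=
  ∏ i, ∏ j, if i < j ∧ σ j < σ i then (w (σ i) * w (σ j)).negOnePow else 1

/-- The word `w` with its `i`-th letter lowered by one. -/
def lower {n : ℕ} (w : Fin n → ℤ) (i : Fin n) : Fin n → ℤ := Function.update w i (w i - 1)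

theorem sum_lower {n : ℕ} (w : Fin n → ℤ) (i : Fin n) : ∑ j, lower w i j = (∑ j, w j) - 1 := by
  rw [lower, Finset.sum_update_of_mem (Finset.mem_univ i),
    ← Finset.add_sum_erase Finset.univ w (Finset.mem_univ i), Finset.sdiff_singleton_eq_erase]
  ring

/-- The differential applied to the `i`-th tensor factor, without sign. -/
def dAt (V : ChainComplex C ℤ) {n : ℕ} (w : Fin n → ℤ) (i : Fin n) :
    tens (fun j => V.X (w j)) ⟶ tens (fun j => V.X (lower w i j)) :=
  tensMap (fun j =>
    if h : j = i then V.d (w j) (lower w i j)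
    else eqToHom (congrArg V.X (by simp [lower, h])))

/-- A structure of algebra over the operad `P` of `C` (seen as an operad in chain complexes,
concentrated in degree zero) on a chain complex `V`. As
`(V ^ ⊗ n)_k = ⨁_{w₁ + ⋯ + wₙ = k} V_{w₁} ⊗ ⋯ ⊗ V_{wₙ}`, and tensor products commute with direct
sums, the structure morphism `P n ⊗ V ^ ⊗ n ⟶ V` is given by its components, indexed by the
words `w`. The symmetry and the differential of `V ^ ⊗ n` are those of the tensor product of
complexes, with the Koszul signs. -/
@[ext]
structure DGStr (P : SymmOperad C) (V : ChainComplex C ℤ) where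
  /-- The components of the structure morphisms. -/
  op : ∀ {n} (w : Fin n → ℤ) (k : ℤ), ∑ i, w i = k →
    (P.obj n ⊗ tens (fun i => V.X (w i)) ⟶ V.X k)
  op_d : ∀ {n} (w : Fin n → ℤ) (k : ℤ) (h : ∑ i, w i = k),
    op w k h ≫ V.d k (k - 1) =
      ∑ i, (∑ j ∈ Finset.Iio i, w j).negOnePow •
        (P.obj n ◁ dAt V w i ≫ op (lower w i) (k - 1) (by rw [sum_lower, h]))
  op_act : ∀ {n} (σ : Equiv.Perm (Fin n)) (w : Fin n → ℤ) (k : ℤ) (h : ∑ i, w i = k),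
    P.act σ ▷ tens (fun i => V.X (w i)) ≫ op w k h =
      koszulSign σ w • (P.obj n ◁ tensPerm σ (fun i => V.X (w i)) ≫
        op (fun i => w (σ i)) k (by rw [Equiv.sum_comp σ w, h]))
  op_unit : ∀ (w : Fin 1 → ℤ),
    P.unit ▷ tens (fun i => V.X (w i)) ≫ op w (w 0) (by simp) =
      (λ_ _).hom ≫ (λ_ (V.X (w 0))).hom
  op_comp : ∀ (a b m : ℕ) (w : Fin (a + m + b) → ℤ) (w' : Fin (a + 1 + b) → ℤ) (k : ℤ)
    (h : ∑ i, w i = k) (h' : ∑ i, w' i = k)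
    (hl : ∀ i, w (posL a m b i) = w' (posL a 1 b i))
    (hm : ∑ i, w (posM a m b i) = w' (posM a 1 b 0))
    (hr : ∀ i, w (posR a m b i) = w' (posR a 1 b i)),
    P.comp a b m ▷ tens (fun i => V.X (w i)) ≫ op w k h =
      (α_ _ _ _).hom ≫
        P.obj (a + 1 + b) ◁ plug a m b (F := fun i => V.X (w i)) (G := fun i => V.X (w' i))
          (fun i => eqToHom (congrArg V.X (hl i)))
          (op (fun i => w (posM a m b i)) _ hm)
          (fun i => eqToHom (congrArg V.X (hr i))) ≫
        op w' k h'

/-- A differential graded algebra over the operad `P`. -/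
structure DGAlg (P : SymmOperad C) where
  /-- The underlying complex. -/
  cx : ChainComplex C ℤ
  /-- The algebra structure. -/
  str : DGStr P cx

namespace DGAlg

variable {P : SymmOperad C}

/-- A morphism of differential graded algebras: a morphism of complexes compatible with the
structure morphisms. -/
@[ext]
structure Hom (A B : DGAlg P) where
  /-- The underlying morphism of complexes. -/
  hom : A.cx ⟶ B.cx
  op_hom : ∀ {n} (w : Fin n → ℤ) (k : ℤ) (h : ∑ i, w i = k),
    A.str.op w k h ≫ hom.f k = P.obj n ◁ tensMap (fun i => hom.f (w i)) ≫ B.str.op w k h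

instance : Category (DGAlg P) where
  Hom A B := Hom A B
  id A := ⟨𝟙 A.cx, fun w k h => by simp [tensMap_id]⟩
  comp f g := ⟨f.hom ≫ g.hom, fun w k h => by
    simp only [HomologicalComplex.comp_f]
    rw [← Category.assoc, f.op_hom, Category.assoc, g.op_hom, tensMap_comp]; simp⟩

end DGAlg

/-- A complex is concentrated in degrees `0` and `1`. -/
def InDegreesZeroOne (V : ChainComplex C ℤ) : Prop := ∀ k : ℤ, k ≠ 0 → k ≠ 1 → IsZero (V.X k)

/-- The category of differential graded `P`-algebras concentrated in degrees `0` and `1`. -/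
abbrev DGAlgLEOne (P : SymmOperad C) : Type _ :=
  ObjectProperty.FullSubcategory (fun A : DGAlg P => InDegreesZeroOne A.cx)

end DG

/-! ### The complex of a crossed module -/

section TwoTerm

open ZeroObject

variable {C : Type u} [Category.{v} C] [Abelian C]

/-- The complex `⋯ ⟶ 0 ⟶ V₁ ⟶ V₀ ⟶ 0 ⟶ ⋯` with `V₁` in degree `1` and `V₀` in degree `0`. -/
def twoTerm {V₁ V₀ : C} (d : V₁ ⟶ V₀) : ChainComplex C ℤ where
  X k := match k with
    | .ofNat 0 => V₀
    | .ofNat 1 => V₁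
    | _ => 0
  d i j := match i, j with
    | .ofNat 1, .ofNat 0 => d
    | _, _ => 0
  shape i j h := by
    split
    · exact absurd rfl h
    · rfl
  d_comp_d' i j k _ _ := by
    split
    · exact comp_zero
    · exact zero_comp

theorem twoTerm_d_eq_zero {V₁ V₀ : C} (d : V₁ ⟶ V₀) {i j : ℤ} (h : ¬ (i = 1 ∧ j = 0)) :
    (twoTerm d).d i j = 0 := by
  dsimp only [twoTerm]
  split
  · exact absurd ⟨rfl, rfl⟩ h
  · rfl

/-- The morphism between two-term complexes induced by a commutative square. -/
def twoTermMap {V₁ V₀ W₁ W₀ : C} {d : V₁ ⟶ V₀} {d' : W₁ ⟶ W₀} (f₁ : V₁ ⟶ W₁) (f₀ : V₀ ⟶ W₀)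
    (h : d ≫ f₀ = f₁ ≫ d') : twoTerm d ⟶ twoTerm d' where
  f k := match k with
    | .ofNat 0 => f₀
    | .ofNat 1 => f₁
    | _ => 0
  comm' i j _ := by
    by_cases hij : i = 1 ∧ j = 0
    · obtain ⟨rfl, rfl⟩ := hij
      exact h.symm
    · rw [twoTerm_d_eq_zero d hij, twoTerm_d_eq_zero d' hij, zero_comp, comp_zero]

/-- The map `V_k ⟶ V₁ ⊕ V₀` which is the inclusion of the summand `V_k` for `k = 0, 1`. -/
def twoTermIncl {V₁ V₀ : C} (d : V₁ ⟶ V₀) : ∀ k : ℤ, (twoTerm d).X k ⟶ V₁ ⊞ V₀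
  | .ofNat 0 => (biprod.inr : V₀ ⟶ V₁ ⊞ V₀)
  | .ofNat 1 => (biprod.inl : V₁ ⟶ V₁ ⊞ V₀)
  | _ => 0

theorem twoTerm_inDegrees {V₁ V₀ : C} (d : V₁ ⟶ V₀) : InDegreesZeroOne (twoTerm d) := by
  intro k h0 h1
  match k, h0, h1 with
  | .ofNat 0, h0, _ => exact absurd rfl h0
  | .ofNat 1, _, h1 => exact absurd rfl h1
  | .ofNat (n + 2), _, _ => exact isZero_zero C
  | .negSucc n, _, _ => exact isZero_zero C

namespace PreXMod

variable [MonoidalCategory C] [SymmetricCategory C] {P : SymmOperad C}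

/-- The complex `V₁ ⟶ V₀` underlying a precrossed module. -/
abbrev cx (M : PreXMod P) : ChainComplex C ℤ := twoTerm M.d.hom

/-- The morphism of complexes underlying a morphism of precrossed modules. -/
abbrev cxMap {M N : PreXMod P} (φ : M ⟶ N) : M.cx ⟶ N.cx :=
  twoTermMap φ.top.hom φ.base.hom (congrArg Alg.Hom.hom φ.comm)

/-- The structure `s` of `P`-algebra on the complex `V₁ ⟶ V₀` is the one given by the algebra
structure of `V₀` in degree `0`, by the module structure of `V₁` over `V₀` (that is, the action
of `V₀` on `V₁`, on tensors with exactly one factor in `V₁`) in degree `1`, and by zero in higher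
degrees. -/
structure IsInduced (M : PreXMod P) (s : DGStr P M.cx) : Prop where
  degree_zero : ∀ n, s.op (fun _ : Fin n => 0) 0 (by simp) = M.base.op n
  degree_one : ∀ {n} (w : Fin n → ℤ) (h : ∑ i, w i = 1),
    s.op w 1 h = P.obj n ◁ tensMap (fun i => twoTermIncl M.d.hom (w i)) ≫ M.action.ρ n
  degree_ge_two : ∀ {n} (w : Fin n → ℤ) (k : ℤ) (h : ∑ i, w i = k), 2 ≤ k → s.op w k h = 0

/-- The differential graded algebra given by an algebra structure on the complex of a precrossed
module. -/
def toDG (M : PreXMod P) (s : DGStr P M.cx) : DGAlgLEOne P :=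
  ⟨⟨M.cx, s⟩, twoTerm_inDegrees M.d.hom⟩

end PreXMod

end TwoTerm

end

end OpdX

/-!
The semidirect product `V₁ ⋊ V₀` of the action is a `P`-algebra on `V₁ ⊕ V₀` with structure map
`(ρ, μ)`, and the structure morphisms of the complex are its restrictions to words in `V₀` and
`V₁`. It preserves degrees on words of degree at most one, because `ρ` vanishes on words in `V₀` and
the projection to `V₀` is a morphism of algebras; so symmetry, units and associativity hold as soon
as they hold in `V₁ ⋊ V₀`, and no Koszul sign occurs in these degrees. The Leibniz rule is needed on
words with one or two letters `V₁`. Equivariance of `d` says that `(v₁, v₀) ↦ d v₁ + v₀` is, like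
the projection, a morphism of algebras `V₁ ⋊ V₀ ⟶ V₀`. Their difference is `d`, and the projection
vanishes on words with a letter `V₁`: this is the rule for one such letter. For two letters the two
terms have opposite signs, and by the Peiffer identity both are equal to `ρ` up to sign.
-/

namespace OpdX

section Positions

variable {a m b : ℕ}

theorem posL_ne_posM (i : Fin a) (j : Fin m) : posL a m b i ≠ posM a m b j :=
  Fin.ne_of_val_ne (show (i : ℕ) ≠ a + j by omega)

theorem posL_ne_posR (i : Fin a) (j : Fin b) : posL a m b i ≠ posR a m b j :=
  Fin.ne_of_val_ne (show (i : ℕ) ≠ a + m + j by omega)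

theorem posM_ne_posR (i : Fin m) (j : Fin b) : posM a m b i ≠ posR a m b j :=
  Fin.ne_of_val_ne (show a + (i : ℕ) ≠ a + m + j by omega)

end Positions

section TensorNaturality

variable {C : Type u} [Category.{v} C] [MonoidalCategory C]

theorem tensMap_one {F G : Fin 1 → C} (f : ∀ i, F i ⟶ G i) : tensMap f = 𝟙_ C ◁ f 0 :=
  id_tensorHom _ _

theorem tensMap_succ {n : ℕ} {F G : Fin (n + 1) → C} (f : ∀ i, F i ⟶ G i) :
    tensMap f = tensMap (fun i : Fin n => f i.castSucc) ⊗ₘ f (Fin.last n) :=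
  rfl

theorem tensSplit_naturality (a : ℕ) : (b : ℕ) → {F G : Fin (a + b) → C} → (f : ∀ i, F i ⟶ G i) →
    tensMap f ≫ (tensSplit a b G).hom = (tensSplit a b F).hom ≫
      (tensMap (fun i => f (Fin.castAdd b i)) ⊗ₘ tensMap (fun j => f (Fin.natAdd a j)))
  | 0, F, G, f => by
      change tensMap f ≫ (ρ_ (tens G)).inv = (ρ_ (tens F)).inv ≫ (tensMap f ⊗ₘ 𝟙 (𝟙_ C))
      simp
  | b + 1, F, G, f => by
      have ih := tensSplit_naturality a b (fun i => f i.castSucc)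
      change (tensMap (fun i : Fin (a + b) => f i.castSucc) ⊗ₘ f (Fin.last (a + b))) ≫
          (tensSplit a b (fun i => G i.castSucc)).hom ▷ G (Fin.last (a + b)) ≫ (α_ _ _ _).hom =
        ((tensSplit a b (fun i => F i.castSucc)).hom ▷ F (Fin.last (a + b)) ≫ (α_ _ _ _).hom) ≫
          (tensMap (fun i => f (Fin.castAdd b i).castSucc) ⊗ₘ
            (tensMap (fun j => f (Fin.natAdd a j).castSucc) ⊗ₘ f (Fin.last (a + b))))
      simp only [← tensorHom_id, Category.assoc, ← associator_naturality,
        tensorHom_comp_tensorHom_assoc, ih, Category.comp_id, Category.id_comp]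

theorem tensSplit₃_naturality (a m b : ℕ) {F G : Fin (a + m + b) → C} (f : ∀ i, F i ⟶ G i) :
    tensMap f ≫ (tensSplit₃ a m b G).hom = (tensSplit₃ a m b F).hom ≫
      ((tensMap (fun i => f (posL a m b i)) ⊗ₘ tensMap (fun i => f (posM a m b i))) ⊗ₘ
        tensMap (fun i => f (posR a m b i))) := by
  simp only [tensSplit₃, Iso.trans_hom, whiskerRightIso_hom, Category.assoc, ← tensorHom_id]
  rw [reassoc_of% (tensSplit_naturality (a + m) b f), tensorHom_comp_tensorHom,
    tensorHom_comp_tensorHom, tensSplit_naturality a m (fun i => f (Fin.castAdd b i)),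
    Category.comp_id, Category.id_comp]

theorem tensMap_eq_tensSplit₃ (a m b : ℕ) {F G : Fin (a + m + b) → C} (f : ∀ i, F i ⟶ G i) :
    tensMap f = (tensSplit₃ a m b F).hom ≫
      ((tensMap (fun i => f (posL a m b i)) ⊗ₘ tensMap (fun i => f (posM a m b i))) ⊗ₘ
        tensMap (fun i => f (posR a m b i))) ≫ (tensSplit₃ a m b G).inv := by
  rw [← Category.assoc, Iso.eq_comp_inv, tensSplit₃_naturality]

theorem tensMap_eq_tensSplit₃_comp (a m b : ℕ) {F H : Fin (a + m + b) → C} {f : ∀ i, F i ⟶ H i}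
    {L : Fin a → C} {l : ∀ i, F (posL a m b i) ⟶ L i} {l' : ∀ i, L i ⟶ H (posL a m b i)}
    {M : Fin m → C} {c : ∀ i, F (posM a m b i) ⟶ M i} {c' : ∀ i, M i ⟶ H (posM a m b i)}
    {R : Fin b → C} {r : ∀ i, F (posR a m b i) ⟶ R i} {r' : ∀ i, R i ⟶ H (posR a m b i)}
    (hl : ∀ i, f (posL a m b i) = l i ≫ l' i) (hc : ∀ i, f (posM a m b i) = c i ≫ c' i)
    (hr : ∀ i, f (posR a m b i) = r i ≫ r' i) :
    tensMap f = (tensSplit₃ a m b F).hom ≫ ((tensMap l ⊗ₘ tensMap c) ⊗ₘ tensMap r) ≫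
      ((tensMap l' ⊗ₘ tensMap c') ⊗ₘ tensMap r') ≫ (tensSplit₃ a m b H).inv := by
  rw [tensMap_eq_tensSplit₃, funext hl, funext hc, funext hr, tensMap_comp, tensMap_comp,
    tensMap_comp, ← tensorHom_comp_tensorHom, ← tensorHom_comp_tensorHom, Category.assoc]

section Braided

variable [BraidedCategory C]

theorem swap_right_naturality {A A' B B' D D' : C} (f : A ⟶ A') (g : B ⟶ B') (h : D ⟶ D') :
    ((f ⊗ₘ g) ⊗ₘ h) ≫ (α_ _ _ _).hom ≫ A' ◁ (β_ _ _).hom ≫ (α_ _ _ _).inv =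
      (α_ _ _ _).hom ≫ A ◁ (β_ _ _).hom ≫ (α_ _ _ _).inv ≫ ((f ⊗ₘ h) ⊗ₘ g) := by
  simp [← id_tensorHom]

theorem swap_left_naturality (Q : C) {A A' B B' : C} (f : A ⟶ A') (g : B ⟶ B') :
    Q ◁ (f ⊗ₘ g) ≫ (α_ _ _ _).inv ≫ (β_ _ _).hom ▷ B' ≫ (α_ _ _ _).hom =
      (α_ _ _ _).inv ≫ (β_ _ _).hom ▷ B ≫ (α_ _ _ _).hom ≫ (f ⊗ₘ Q ◁ g) := by
  simp only [← id_tensorHom, ← tensorHom_id, associator_inv_naturality_assoc,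
    tensorHom_comp_tensorHom_assoc, BraidedCategory.braiding_naturality, Category.comp_id,
    Category.id_comp, ← associator_naturality]

end Braided

variable [SymmetricCategory C]

theorem tensExtract_naturality : {n : ℕ} → {F G : Fin (n + 1) → C} → (f : ∀ i, F i ⟶ G i) →
    (i : Fin (n + 1)) →
    tensMap f ≫ tensExtract G i =
      tensExtract F i ≫ (tensMap (fun j => f (i.succAbove j)) ⊗ₘ f i)
  | 0, F, G, f, i => by
      change (𝟙 (𝟙_ C) ⊗ₘ f (Fin.last 0)) ≫ 𝟙_ C ◁ eqToHom _ =
        𝟙_ C ◁ eqToHom _ ≫ (𝟙 (𝟙_ C) ⊗ₘ f i)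
      rw [id_tensorHom, id_tensorHom, ← whiskerLeft_comp, ← whiskerLeft_comp,
        eqToHom_naturality f (Subsingleton.elim (α := Fin 1) _ _)]
  | n + 1, F, G, f, i => by
      by_cases h : i = Fin.last (n + 1)
      · have hsucc (j : Fin (n + 1)) : j.castSucc = i.succAbove j := by rw [h, Fin.succAbove_last]
        simp only [tensExtract, dif_pos h]
        rw [tensMap_succ, tensorHom_comp_tensorHom, tensorHom_comp_tensorHom, ← tensMap_comp,
          ← tensMap_comp, eqToHom_naturality f h.symm]
        simp only [eqToHom_naturality f (hsucc _)]
      · have ih := tensExtract_naturality (fun j : Fin (n + 1) => f j.castSucc) (i.castPred h)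
        have hsucc (j : Fin n) : ((i.castPred h).succAbove j).castSucc = i.succAbove j.castSucc :=
          by rw [← Fin.castSucc_succAbove_castSucc, Fin.castSucc_castPred]
        have hf : (fun j : Fin n => eqToHom (congrArg F (hsucc j)) ≫ f (i.succAbove j.castSucc)) =
            fun j => f ((i.castPred h).succAbove j).castSucc ≫ eqToHom (congrArg G (hsucc j)) :=
          funext fun j => (eqToHom_naturality f (hsucc j)).symm
        simp only [tensExtract, dif_neg h]
        rw [tensMap_succ f, tensMap_succ fun j => f (i.succAbove j)]
        simp only [Category.assoc, tensorHom_comp_tensorHom]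
        rw [← tensMap_comp, ← eqToHom_naturality f (Fin.castSucc_castPred i h),
          ← eqToHom_naturality f (Fin.succAbove_ne_last_last h).symm, hf, tensMap_comp,
          ← tensorHom_comp_tensorHom, ← tensorHom_comp_tensorHom,
          ← reassoc_of% @swap_right_naturality, ← tensorHom_id, tensorHom_comp_tensorHom_assoc, ih,
          ← tensorHom_id, tensorHom_comp_tensorHom_assoc, Category.comp_id, Category.id_comp]

theorem tensPerm_naturality : {n : ℕ} → (σ : Equiv.Perm (Fin n)) → {F G : Fin n → C} →
    (f : ∀ i, F i ⟶ G i) →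
    tensMap f ≫ tensPerm σ G = tensPerm σ F ≫ tensMap (fun i => f (σ i))
  | 0, _, _, _, _ => rfl
  | n + 1, σ, F, G, f => by
      have ih := tensPerm_naturality (residual σ) (fun j => f ((σ (Fin.last n)).succAbove j))
      have hf : (fun j : Fin n => eqToHom (congrArg F (residual_spec σ j)) ≫ f (σ j.castSucc)) =
          fun j => f ((σ (Fin.last n)).succAbove (residual σ j)) ≫
            eqToHom (congrArg G (residual_spec σ j)) :=
        funext fun j => (eqToHom_naturality f (residual_spec σ j)).symm
      simp only [tensPerm]
      rw [reassoc_of% (tensExtract_naturality f (σ (Fin.last n))), Category.assoc,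
        tensMap_succ fun i => f (σ i), ← tensorHom_id, ← tensorHom_id, tensorHom_comp_tensorHom,
        tensorHom_comp_tensorHom, Category.comp_id, Category.id_comp, Category.assoc,
        ← tensMap_comp, hf, tensMap_comp, reassoc_of% ih]

theorem whiskerLeft_tensMap_plug (a m b : ℕ) {F F' : Fin (a + m + b) → C}
    {G : Fin (a + 1 + b) → C} {Q : C} (g : ∀ i, F i ⟶ F' i)
    (l : ∀ i, F' (posL a m b i) ⟶ G (posL a 1 b i))
    (f : Q ⊗ tens (fun i => F' (posM a m b i)) ⟶ G (posM a 1 b 0))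
    (r : ∀ i, F' (posR a m b i) ⟶ G (posR a 1 b i)) :
    Q ◁ tensMap g ≫ plug a m b l f r =
      plug a m b (fun i => g (posL a m b i) ≫ l i)
        (Q ◁ tensMap (fun i => g (posM a m b i)) ≫ f)
        (fun i => g (posR a m b i) ≫ r i) := by
  simp only [plug]
  rw [← whiskerLeft_comp_assoc, tensSplit₃_naturality, tensMap_comp, tensMap_comp, Category.assoc,
    ← tensorHom_comp_tensorHom, ← reassoc_of% @swap_left_naturality,
    MonoidalCategory.whiskerLeft_comp, Category.assoc, ← id_tensorHom Q (_ ⊗ₘ _),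
    associator_inv_naturality_assoc, id_tensorHom, comp_whiskerRight (Q ◁ _), Category.assoc,
    MonoidalCategory.tensorHom_def, Category.assoc, MonoidalCategory.whiskerLeft_comp,
    Category.assoc, whisker_exchange_assoc]

theorem plug_tensMap (a m b : ℕ) {F : Fin (a + m + b) → C}
    {G G' : Fin (a + 1 + b) → C} {Q : C}
    (l : ∀ i, F (posL a m b i) ⟶ G (posL a 1 b i))
    (f : Q ⊗ tens (fun i => F (posM a m b i)) ⟶ G (posM a 1 b 0))
    (r : ∀ i, F (posR a m b i) ⟶ G (posR a 1 b i)) (g : ∀ i, G i ⟶ G' i) :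
    plug a m b l f r ≫ tensMap g =
      plug a m b (fun i => l i ≫ g (posL a 1 b i)) (f ≫ g (posM a 1 b 0))
        (fun i => r i ≫ g (posR a 1 b i)) := by
  simp only [plug, Category.assoc]
  rw [tensMap_eq_tensSplit₃ a 1 b g, Iso.inv_hom_id_assoc, tensMap_comp, tensMap_comp,
    tensMap_one fun i => g (posM a 1 b i), ← MonoidalCategory.tensorHom_def_assoc,
    ← MonoidalCategory.tensorHom_def_assoc, tensorHom_comp_tensorHom_assoc]
  simp only [Category.assoc, tensorHom_comp_tensorHom, ← leftUnitor_inv_naturality]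

end TensorNaturality

namespace SymmOperad

variable {C : Type u} [Category.{v} C] [MonoidalCategory C] [SymmetricCategory C]

instance isIso_act (P : SymmOperad C) {m n : ℕ} (σ : Fin m ≃ Fin n) : IsIso (P.act σ) :=
  ⟨P.act σ.symm, by rw [← P.act_trans, Equiv.self_trans_symm, P.act_refl],
    by rw [← P.act_trans, Equiv.symm_trans_self, P.act_refl]⟩

end SymmOperad

section Additive

variable {C : Type u} [Category.{v} C] [Preadditive C] [MonoidalCategory C]

theorem monoidalPreadditive_of_monoidalClosed [HasZeroObject C] [HasBinaryBiproducts C]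
    [BraidedCategory C] [MonoidalClosed C] : MonoidalPreadditive C := by
  have hl (X : C) : (tensorLeft X).Additive := by
    have : PreservesColimitsOfSize.{0, 0} (tensorLeft X) :=
      (ihom.adjunction X).leftAdjoint_preservesColimits
    have := preservesBinaryBiproducts_of_preservesBinaryCoproducts (tensorLeft X)
    exact Functor.additive_of_preservesBinaryBiproducts _
  have hr (X : C) : (tensorRight X).Additive :=
    Functor.additive_of_iso (BraidedCategory.tensorLeftIsoTensorRight X)
  exact
    { whiskerLeft_zero := (tensorLeft _).map_zero _ _
      zero_whiskerRight := (tensorRight _).map_zero _ _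
      whiskerLeft_add := fun _ _ => (tensorLeft _).map_add
      add_whiskerRight := fun _ _ => (tensorRight _).map_add }

variable [MonoidalPreadditive C]

theorem tensMap_eq_zero : {n : ℕ} → {F G : Fin n → C} → (f : ∀ i, F i ⟶ G i) → (i : Fin n) →
    f i = 0 → tensMap f = 0
  | 0, _, _, _, i, _ => i.elim0
  | n + 1, _, _, f, i, h => by
      rw [tensMap_succ]
      induction i using Fin.lastCases with
      | last => rw [h, MonoidalPreadditive.tensor_zero]
      | cast i => rw [tensMap_eq_zero (fun i : Fin n => f i.castSucc) i h,
          MonoidalPreadditive.zero_tensor]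

theorem isZero_tens {n : ℕ} {F : Fin n → C} (i : Fin n) (h : IsZero (F i)) : IsZero (tens F) := by
  rw [IsZero.iff_id_eq_zero, ← tensMap_id]
  exact tensMap_eq_zero _ i (h.eq_of_src _ _)

end Additive

section Biproduct

variable {C : Type u} [Category.{v} C] [HasZeroMorphisms C] {X Y Z : C} [HasBinaryBiproduct X Y]

theorem eq_comp_fst_inl {f : Z ⟶ X ⊞ Y} (h : f ≫ biprod.snd = 0) :
    f = (f ≫ biprod.fst) ≫ biprod.inl := by
  apply biprod.hom_ext <;> simp [h]

theorem eq_comp_snd_inr {f : Z ⟶ X ⊞ Y} (h : f ≫ biprod.fst = 0) :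
    f = (f ≫ biprod.snd) ≫ biprod.inr := by
  apply biprod.hom_ext <;> simp [h]

end Biproduct

noncomputable section

/-! ### Evaluation of operations -/

namespace Alg

variable {C : Type u} [Category.{v} C] [MonoidalCategory C] [SymmetricCategory C]
variable {P : SymmOperad C} (A : Alg P)

/-- The evaluation of the operations of arity `n` on a family of generalized elements
`g i : F i ⟶ A.X` of an algebra. The identities of an algebra take their usual form on generalized
elements, without tensor powers of the underlying object. -/
def eval {n : ℕ} {F : Fin n → C} (g : ∀ i, F i ⟶ A.X) : P.obj n ⊗ tens F ⟶ A.X :=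
  P.obj n ◁ tensMap g ≫ A.op n

theorem eval_id (n : ℕ) : A.eval (fun _ : Fin n => 𝟙 A.X) = A.op n := by
  rw [eval, tensMap_id, whiskerLeft_id, Category.id_comp]

theorem whiskerLeft_tensMap_eval {n : ℕ} {F G : Fin n → C} (f : ∀ i, F i ⟶ G i)
    (g : ∀ i, G i ⟶ A.X) : P.obj n ◁ tensMap f ≫ A.eval g = A.eval (fun i => f i ≫ g i) := by
  rw [eval, eval, tensMap_comp, whiskerLeft_comp_assoc]

theorem eval_hom {A B : Alg P} (φ : A ⟶ B) {n : ℕ} {F : Fin n → C} (g : ∀ i, F i ⟶ A.X) :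
    A.eval g ≫ φ.hom = B.eval (fun i => g i ≫ φ.hom) := by
  rw [eval, Category.assoc, φ.op_hom, ← whiskerLeft_tensMap_eval, eval]

theorem eval_act {n : ℕ} (σ : Equiv.Perm (Fin n)) {F : Fin n → C} (g : ∀ i, F i ⟶ A.X) :
    P.act σ ▷ tens F ≫ A.eval g = P.obj n ◁ tensPerm σ F ≫ A.eval (fun i => g (σ i)) := by
  rw [eval, eval, ← whisker_exchange_assoc, A.op_act, ← whiskerLeft_comp_assoc,
    ← whiskerLeft_comp_assoc, tensPerm_naturality]

theorem eval_unit {F : Fin 1 → C} (g : ∀ i, F i ⟶ A.X) :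
    P.unit ▷ tens F ≫ A.eval g = (λ_ _).hom ≫ (λ_ (F 0)).hom ≫ g 0 := by
  rw [eval, ← whisker_exchange_assoc, A.op_unit, leftUnitor_naturality_assoc, tensMap_one,
    leftUnitor_naturality]
  rfl

theorem eval_comp {a b m : ℕ} {F : Fin (a + m + b) → C} {G : Fin (a + 1 + b) → C}
    {g : ∀ i, F i ⟶ A.X} {h : ∀ i, G i ⟶ A.X}
    {l : ∀ i, F (posL a m b i) ⟶ G (posL a 1 b i)}
    {f : P.obj m ⊗ tens (fun i => F (posM a m b i)) ⟶ G (posM a 1 b 0)}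
    {r : ∀ i, F (posR a m b i) ⟶ G (posR a 1 b i)}
    (hl : ∀ i, l i ≫ h (posL a 1 b i) = g (posL a m b i))
    (hf : f ≫ h (posM a 1 b 0) = A.eval (fun i => g (posM a m b i)))
    (hr : ∀ i, r i ≫ h (posR a 1 b i) = g (posR a m b i)) :
    P.comp a b m ▷ tens F ≫ A.eval g =
      (α_ _ _ _).hom ≫ P.obj (a + 1 + b) ◁ plug a m b l f r ≫ A.eval h := by
  have hplug : plug a m b l f r ≫ tensMap h =
      P.obj m ◁ tensMap g ≫ plug a m b (fun _ => 𝟙 A.X) (A.op m) (fun _ => 𝟙 A.X) := by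
    rw [plug_tensMap, whiskerLeft_tensMap_plug, hf, eval]
    simp only [hl, hr, Category.comp_id]
  rw [eval, eval, ← whisker_exchange_assoc, A.op_comp, tensor_whiskerLeft, Category.assoc,
    Category.assoc, Iso.inv_hom_id_assoc, ← whiskerLeft_comp_assoc, ← whiskerLeft_comp_assoc, hplug]

theorem eval_eq_zero [Preadditive C] [MonoidalPreadditive C] {n : ℕ} {F : Fin n → C}
    {g : ∀ i, F i ⟶ A.X} (i : Fin n) (h : g i = 0) : A.eval g = 0 := by
  rw [eval, tensMap_eq_zero g i h, MonoidalPreadditive.whiskerLeft_zero, zero_comp]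

end Alg

/-! ### The semidirect product of an action -/

section Semidirect

variable {C : Type u} [Category.{v} C] [Abelian C] [MonoidalCategory C] [SymmetricCategory C]
variable {P : SymmOperad C}

theorem extendOp_fst (B : Alg P) {X : C} {n : ℕ} (ρ : P.obj n ⊗ tpow (X ⊞ B.X) n ⟶ X) :
    extendOp B ρ ≫ biprod.fst = ρ :=
  biprod.lift_fst _ _

theorem extendOp_snd (B : Alg P) {X : C} {n : ℕ} (ρ : P.obj n ⊗ tpow (X ⊞ B.X) n ⟶ X) :
    extendOp B ρ ≫ biprod.snd = B.eval (fun _ => biprod.snd) :=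
  biprod.lift_snd _ _

theorem selfAction_eq_eval_sub_eval [MonoidalPreadditive C] (B : Alg P) (n : ℕ) :
    selfAction B n =
      B.eval (fun _ => biprod.desc (𝟙 B.X) (𝟙 B.X)) - B.eval (fun _ => biprod.snd) := by
  have whiskerLeft_sub {X Y : C} (f g : X ⟶ Y) : P.obj n ◁ (f - g) = P.obj n ◁ f - P.obj n ◁ g :=
    (tensorLeft (P.obj n)).map_sub
  simp only [selfAction, Alg.eval, Preadditive.sub_comp, Category.id_comp, ← tensMap_comp,
    Category.assoc, biprod.inr_desc, Category.comp_id, whiskerLeft_sub]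

namespace Action

variable {B X : Alg P} (A : Action B X)

theorem ρ_unit : P.unit ▷ tpow (X.X ⊞ B.X) 1 ≫ A.ρ 1 = (λ_ _).hom ≫ (λ_ _).hom ≫ biprod.fst := by
  have precomp {Y : C} (f : Y ⟶ X.X ⊞ B.X) :
      f ≫ (λ_ _).inv ≫ (λ_ _).inv ≫ P.unit ▷ tpow (X.X ⊞ B.X) 1 ≫ A.ρ 1 =
        (λ_ _).inv ≫ (λ_ _).inv ≫ P.unit ▷ tpow Y 1 ≫
          P.obj 1 ◁ tensMap (fun _ : Fin 1 => f) ≫ A.ρ 1 := by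
    rw [tensMap_one, ← whisker_exchange_assoc, leftUnitor_inv_naturality_assoc,
      leftUnitor_inv_naturality_assoc]
  rw [← Iso.inv_comp_eq, ← Iso.inv_comp_eq]
  apply biprod.hom_ext'
  · rw [precomp, A.ρ_compat, X.op_unit]
    simp
  · rw [precomp, A.ρ_base]
    simp

/-- The semidirect product `X ⋊ B` of an action of `B` on `X`: the operations are those of `B` on
the summand `B` and given by the action on the summand `X`. -/
abbrev semidirect : Alg P where
  X := X.X ⊞ B.X
  op n := extendOp B (A.ρ n)
  op_act σ := by
    apply biprod.hom_ext
    · simp only [Category.assoc, extendOp_fst, A.ρ_act]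
    · simp only [Category.assoc, extendOp_snd]
      exact B.eval_act σ _
  op_unit := by
    apply biprod.hom_ext
    · simp only [Category.assoc, extendOp_fst, A.ρ_unit]
    · simp only [Category.assoc, extendOp_snd]
      exact B.eval_unit _
  op_comp a b m := by
    apply biprod.hom_ext
    · simp only [Category.assoc, extendOp_fst, A.ρ_comp]
    · simp only [Category.assoc, extendOp_snd]
      exact B.eval_comp (fun _ => Category.id_comp _) (extendOp_snd B _)
        (fun _ => Category.id_comp _)

/-- The projection of the semidirect product `X ⋊ B` to `B`. -/
def semidirectSnd : A.semidirect ⟶ B where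
  hom := biprod.snd
  op_hom _ := extendOp_snd B _

end Action

namespace PreXMod

/-- The semidirect product `V₁ ⋊ V₀` of a precrossed module `V₁ ⟶ V₀`. -/
abbrev semidirect (M : PreXMod P) : Alg P := M.action.semidirect

/-- The morphism `V₁ ⋊ V₀ ⟶ V₀` which is `d` on `V₁` and the identity on `V₀`. It is the target of
the internal category attached to `d : V₁ ⟶ V₀`, whose source is the projection. -/
def target [MonoidalPreadditive C] (M : PreXMod P) : M.semidirect ⟶ M.base where
  hom := biprod.desc M.d.hom (𝟙 M.base.X)
  op_hom n := by
    have hdesc : biprod.desc M.d.hom (𝟙 M.base.X) = biprod.fst ≫ M.d.hom + biprod.snd := by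
      apply biprod.hom_ext' <;> simp
    have hmap : biprod.map M.d.hom (𝟙 M.base.X) ≫ biprod.desc (𝟙 M.base.X) (𝟙 M.base.X) =
        biprod.desc M.d.hom (𝟙 M.base.X) := by
      apply biprod.hom_ext' <;> simp
    change extendOp M.base (M.action.ρ n) ≫ _ = M.base.eval _
    calc extendOp M.base (M.action.ρ n) ≫ biprod.desc M.d.hom (𝟙 M.base.X)
        = M.action.ρ n ≫ M.d.hom + M.base.eval (fun _ => biprod.snd) := by
          rw [hdesc, Preadditive.comp_add, ← Category.assoc, extendOp_fst, extendOp_snd]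
      _ = M.base.eval (fun _ => biprod.desc M.d.hom (𝟙 M.base.X)) := by
          rw [M.equivariant, selfAction_eq_eval_sub_eval, Preadditive.comp_sub,
            Alg.whiskerLeft_tensMap_eval, Alg.whiskerLeft_tensMap_eval]
          simp only [hmap, biprod.map_snd, Category.comp_id, sub_add_cancel]

theorem fst_d_eq_target_sub_snd [MonoidalPreadditive C] (M : PreXMod P) :
    biprod.fst ≫ M.d.hom = M.target.hom - M.action.semidirectSnd.hom := by
  apply biprod.hom_ext' <;> simp [target, Action.semidirectSnd]

/-- The morphism of semidirect products induced by a morphism of precrossed modules. -/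
def semidirectMap {M N : PreXMod P} (φ : M ⟶ N) : M.semidirect ⟶ N.semidirect where
  hom := biprod.map φ.top.hom φ.base.hom
  op_hom n := by
    apply biprod.hom_ext
    · simp only [Category.assoc, biprod.map_fst, extendOp_fst, reassoc_of% @extendOp_fst]
      exact φ.action n
    · simp only [Category.assoc, biprod.map_snd, extendOp_snd, reassoc_of% @extendOp_snd,
        Alg.whiskerLeft_tensMap_eval]
      exact Alg.eval_hom φ.base _

end PreXMod

end Semidirect

/-! ### The Peiffer identity in arbitrary positions -/

namespace PreXMod.Peiffer

variable {C : Type u} [Category.{v} C] [Abelian C] [MonoidalCategory C] [SymmetricCategory C]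
variable {P : SymmOperad C} {M : PreXMod P}

theorem eval_update_initial (hM : M.Peiffer) {r : ℕ} {F : Fin (1 + 1 + r) → C}
    (g : ∀ i, F i ⟶ M.semidirect.X) (hp : g (posL 1 1 r 0) ≫ biprod.snd = 0)
    (hq : g (posM 1 1 r 0) ≫ biprod.snd = 0) (hr : ∀ j, g (posR 1 1 r j) ≫ biprod.fst = 0) :
    M.semidirect.eval (Function.update g (posM 1 1 r 0)
        (g (posM 1 1 r 0) ≫ biprod.fst ≫ M.d.hom ≫ biprod.inr)) ≫ biprod.fst =
      M.semidirect.eval g ≫ biprod.fst := by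
  set g' := Function.update g (posM 1 1 r 0)
    (g (posM 1 1 r 0) ≫ biprod.fst ≫ M.d.hom ≫ biprod.inr)
  have hL (i : Fin 1) : g (posL 1 1 r i) = (g (posL 1 1 r i) ≫ biprod.fst) ≫ biprod.inl :=
    eq_comp_fst_inl (by rwa [Subsingleton.elim i 0])
  have hMid (i : Fin 1) : g (posM 1 1 r i) = (g (posM 1 1 r i) ≫ biprod.fst) ≫ biprod.inl :=
    eq_comp_fst_inl (by rwa [Subsingleton.elim i 0])
  have hR (i : Fin r) : g (posR 1 1 r i) = (g (posR 1 1 r i) ≫ biprod.snd) ≫ biprod.inr :=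
    eq_comp_snd_inr (hr i)
  have hL' (i : Fin 1) : g' (posL 1 1 r i) = (g (posL 1 1 r i) ≫ biprod.fst) ≫ biprod.inl :=
    (Function.update_of_ne (posL_ne_posM _ _) _ _).trans (hL i)
  have hMid' (i : Fin 1) : g' (posM 1 1 r i) =
      (g (posM 1 1 r i) ≫ biprod.fst) ≫ M.d.hom ≫ biprod.inr := by
    rw [Subsingleton.elim i 0, Category.assoc]
    exact Function.update_self ..
  have hR' (i : Fin r) : g' (posR 1 1 r i) = (g (posR 1 1 r i) ≫ biprod.snd) ≫ biprod.inr :=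
    (Function.update_of_ne (posM_ne_posR _ _).symm _ _).trans (hR i)
  have key := hM 1 r
  simp only [MonoidalCategory.whiskerLeft_comp, Category.assoc] at key
  simp only [Alg.eval, Category.assoc, extendOp_fst]
  rw [tensMap_eq_tensSplit₃_comp 1 1 r hL hMid hR, tensMap_eq_tensSplit₃_comp 1 1 r hL' hMid' hR']
  simp only [MonoidalCategory.whiskerLeft_comp, Category.assoc, key]

theorem eval_update (hM : M.Peiffer) {n : ℕ} {F : Fin n → C} (g : ∀ i, F i ⟶ M.semidirect.X)
    {p q : Fin n} (hpq : p ≠ q) (hp : g p ≫ biprod.snd = 0) (hq : g q ≫ biprod.snd = 0)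
    (hr : ∀ j, j ≠ p → j ≠ q → g j ≫ biprod.fst = 0) :
    M.semidirect.eval (Function.update g q (g q ≫ biprod.fst ≫ M.d.hom ≫ biprod.inr)) ≫
        biprod.fst =
      M.semidirect.eval g ≫ biprod.fst := by
  obtain ⟨r, rfl⟩ : ∃ r, n = 1 + 1 + r := ⟨n - 2, by omega⟩
  obtain ⟨σ, rfl, rfl⟩ : ∃ σ : Equiv.Perm (Fin (1 + 1 + r)),
      σ (posL 1 1 r 0) = p ∧ σ (posM 1 1 r 0) = q :=
    MulAction.is_two_pretransitive_iff.1 (Equiv.Perm.isMultiplyPretransitive _ 2)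
      (posL_ne_posM _ _) hpq
  have hinit := hM.eval_update_initial (fun i => g (σ i)) hp hq fun j => hr _
    (σ.injective.ne (posL_ne_posR _ _).symm) (σ.injective.ne (posM_ne_posR _ _).symm)
  rw [← cancel_epi (P.act σ ▷ tens F), reassoc_of% Alg.eval_act, reassoc_of% Alg.eval_act, ← hinit,
    Function.update_comp_eq_of_injective' g σ.injective]

end PreXMod.Peiffer

/-! ### Words in the degrees zero and one -/

section Words

/-- A word in the letters `0` and `1`. The other words index zero summands of the tensor powers of
a complex concentrated in degrees `0` and `1`. -/
def IsBinary {ι : Type*} (w : ι → ℤ) : Prop := ∀ i, w i = 0 ∨ w i = 1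

namespace IsBinary

variable {ι : Type*} {w : ι → ℤ}

theorem sum_comp_nonneg (hw : IsBinary w) {κ : Type*} [Fintype κ] (e : κ → ι) :
    0 ≤ ∑ j, w (e j) :=
  Finset.sum_nonneg fun j _ => by rcases hw (e j) with h | h <;> omega

variable [Fintype ι]

theorem sum_eq_card (hw : IsBinary w) : ∑ i, w i = (Finset.univ.filter (w · = 1)).card := by
  rw [Finset.natCast_card_filter]
  exact Finset.sum_congr rfl fun i _ => by rcases hw i with h | h <;> simp [h]

theorem eq_zero_of_sum_eq_zero (hw : IsBinary w) (h : ∑ i, w i = 0) : w = 0 := by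
  rw [hw.sum_eq_card, Nat.cast_eq_zero, Finset.card_eq_zero, Finset.filter_eq_empty_iff] at h
  exact funext fun i => (hw i).resolve_right (h (Finset.mem_univ i))

theorem exists_eq_one_iff_of_sum_eq_one (hw : IsBinary w) (h : ∑ i, w i = 1) :
    ∃ i, ∀ j, w j = 1 ↔ j = i := by
  rw [hw.sum_eq_card, Nat.cast_eq_one, Finset.card_eq_one] at h
  obtain ⟨i, hi⟩ := h
  exact ⟨i, by simpa [Finset.ext_iff] using hi⟩

theorem exists_eq_one_iff_of_sum_eq_two [LinearOrder ι] (hw : IsBinary w) (h : ∑ i, w i = 2) :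
    ∃ p q, p < q ∧ ∀ j, w j = 1 ↔ j = p ∨ j = q := by
  obtain ⟨p, q, hne, hpq⟩ := Finset.card_eq_two.1 (Nat.cast_injective (hw.sum_eq_card.symm.trans h))
  have hpq : ∀ j, w j = 1 ↔ j = p ∨ j = q := by simpa [Finset.ext_iff] using hpq
  rcases hne.lt_or_gt with hlt | hlt
  · exact ⟨p, q, hlt, hpq⟩
  · exact ⟨q, p, hlt, fun j => (hpq j).trans or_comm⟩

theorem mul_eq_zero_of_sum_le_one (hw : IsBinary w) (h : ∑ i, w i ≤ 1) {i j : ι} (hij : i ≠ j) :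
    w i * w j = 0 := by
  rw [hw.sum_eq_card, Nat.cast_le_one, Finset.card_le_one] at h
  rcases hw i with hi | hi
  · rw [hi, zero_mul]
  · rcases hw j with hj | hj
    · rw [hj, mul_zero]
    · exact absurd (h i (by simpa) j (by simpa)) hij

theorem koszulSign_eq_one {n : ℕ} {w : Fin n → ℤ} (hw : IsBinary w) (h : ∑ i, w i ≤ 1)
    (σ : Equiv.Perm (Fin n)) : koszulSign σ w = 1 := by
  refine Finset.prod_eq_one fun i _ => Finset.prod_eq_one fun j _ => ?_
  split_ifs with hij
  · rw [hw.mul_eq_zero_of_sum_le_one h hij.2.ne', Int.negOnePow_zero]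
  · rfl

end IsBinary

end Words

/-! ### Two-term complexes -/

namespace InDegreesZeroOne

variable {C : Type u} [Category.{v} C] [Abelian C] {V : ChainComplex C ℤ}

theorem hom_ext (hV : InDegreesZeroOne V) {W : ChainComplex C ℤ} {f g : V ⟶ W}
    (h₀ : f.f 0 = g.f 0) (h₁ : f.f 1 = g.f 1) : f = g := by
  ext k
  by_cases hk₀ : k = 0
  · rw [hk₀, h₀]
  by_cases hk₁ : k = 1
  · rw [hk₁, h₁]
  · exact (hV k hk₀ hk₁).eq_of_src _ _

theorem tensor_tens_hom_ext [MonoidalCategory C] [MonoidalPreadditive C] (hV : InDegreesZeroOne V)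
    {n : ℕ} {w : Fin n → ℤ} {k : ℤ} {Q : C} {f g : Q ⊗ tens (fun i => V.X (w i)) ⟶ V.X k}
    (h : IsBinary w → k = 0 ∨ k = 1 → f = g) : f = g := by
  by_cases hk : k = 0 ∨ k = 1
  · by_cases hw : IsBinary w
    · exact h hw hk
    · simp only [IsBinary, not_forall, not_or] at hw
      obtain ⟨i, hi₀, hi₁⟩ := hw
      exact ((tensorLeft Q).map_isZero (isZero_tens i (hV _ hi₀ hi₁))).eq_of_src _ _
  · rw [not_or] at hk
    exact (hV k hk.1 hk.2).eq_of_tgt _ _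

end InDegreesZeroOne

section TwoTerm

variable {C : Type u} [Category.{v} C] [Abelian C] {V₁ V₀ : C} (d : V₁ ⟶ V₀)

/-- The map `V₁ ⊕ V₀ ⟶ V_k` which is the projection to the summand `V_k` for `k = 0, 1`. -/
def twoTermProj : ∀ k : ℤ, V₁ ⊞ V₀ ⟶ (twoTerm d).X k
  | .ofNat 0 => (biprod.snd : V₁ ⊞ V₀ ⟶ V₀)
  | .ofNat 1 => (biprod.fst : V₁ ⊞ V₀ ⟶ V₁)
  | _ => 0

theorem twoTermIncl_proj : ∀ k : ℤ, twoTermIncl d k ≫ twoTermProj d k = 𝟙 ((twoTerm d).X k)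
  | .ofNat 0 => biprod.inr_snd
  | .ofNat 1 => biprod.inl_fst
  | .ofNat (_ + 2) => (isZero_zero C).eq_of_src _ _
  | .negSucc _ => (isZero_zero C).eq_of_src _ _

theorem twoTermIncl_fst : ∀ {k : ℤ}, k ≠ 1 → twoTermIncl d k ≫ biprod.fst = 0
  | .ofNat 0, _ => biprod.inr_fst
  | .ofNat 1, h => absurd rfl h
  | .ofNat (_ + 2), _ => zero_comp
  | .negSucc _, _ => zero_comp

theorem twoTermIncl_snd : ∀ {k : ℤ}, k ≠ 0 → twoTermIncl d k ≫ biprod.snd = 0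
  | .ofNat 0, h => absurd rfl h
  | .ofNat 1, _ => biprod.inl_snd
  | .ofNat (_ + 2), _ => zero_comp
  | .negSucc _, _ => zero_comp

theorem eqToHom_twoTermIncl {k l : ℤ} (h : k = l) :
    eqToHom (congrArg (twoTerm d).X h) ≫ twoTermIncl d l = twoTermIncl d k := by
  subst h
  rw [eqToHom_refl, Category.id_comp]

theorem twoTerm_d_incl {k l : ℤ} (h : l = k - 1) :
    (twoTerm d).d k l ≫ twoTermIncl d l =
      twoTermIncl d k ≫ biprod.fst ≫ d ≫ biprod.inr := by
  by_cases hk : k = 1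
  · subst hk h
    exact (biprod.inl_fst_assoc _).symm
  · rw [twoTerm_d_eq_zero d fun hkl => hk hkl.1, ← Category.assoc, twoTermIncl_fst d hk, zero_comp,
      zero_comp]

theorem dAt_tensMap_twoTermIncl [MonoidalCategory C] {n : ℕ} (w : Fin n → ℤ) (i : Fin n) :
    dAt (twoTerm d) w i ≫ tensMap (fun j => twoTermIncl d (lower w i j)) =
      tensMap (Function.update (fun j => twoTermIncl d (w j)) i
        (twoTermIncl d (w i) ≫ biprod.fst ≫ d ≫ biprod.inr)) := by
  rw [dAt, ← tensMap_comp]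
  congr 1
  funext j
  split_ifs with hj
  · subst hj
    rw [Function.update_self]
    exact twoTerm_d_incl d (by simp [lower])
  · rw [Function.update_of_ne hj]
    exact eqToHom_twoTermIncl d (by simp [lower, hj])

theorem dAt_twoTerm_eq_zero [MonoidalCategory C] [MonoidalPreadditive C] {n : ℕ} {w : Fin n → ℤ}
    {i : Fin n} (hi : w i ≠ 1) : dAt (twoTerm d) w i = 0 := by
  refine tensMap_eq_zero _ i ?_
  rw [dif_pos rfl]
  exact twoTerm_d_eq_zero d fun h => hi h.1

variable {d} {W₁ W₀ : C} {d' : W₁ ⟶ W₀} (f₁ : V₁ ⟶ W₁) (f₀ : V₀ ⟶ W₀) (h : d ≫ f₀ = f₁ ≫ d')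

theorem twoTermMap_incl : ∀ k : ℤ, (twoTermMap f₁ f₀ h).f k ≫ twoTermIncl d' k =
    twoTermIncl d k ≫ biprod.map f₁ f₀
  | .ofNat 0 => (biprod.inr_map f₁ f₀).symm
  | .ofNat 1 => (biprod.inl_map f₁ f₀).symm
  | .ofNat (_ + 2) => (isZero_zero C).eq_of_src _ _
  | .negSucc _ => (isZero_zero C).eq_of_src _ _

theorem twoTermProj_map : ∀ k : ℤ, twoTermProj d k ≫ (twoTermMap f₁ f₀ h).f k =
    biprod.map f₁ f₀ ≫ twoTermProj d' k
  | .ofNat 0 => (biprod.map_snd f₁ f₀).symm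
  | .ofNat 1 => (biprod.map_fst f₁ f₀).symm
  | .ofNat (_ + 2) => (isZero_zero C).eq_of_tgt _ _
  | .negSucc _ => (isZero_zero C).eq_of_tgt _ _

end TwoTerm

/-! ### The differential graded algebra of a crossed module -/

namespace PreXMod

variable {C : Type u} [Category.{v} C] [Abelian C] [MonoidalCategory C] [SymmetricCategory C]
variable {P : SymmOperad C} (M : PreXMod P)

/-- The restriction of the structure morphisms of `V₁ ⋊ V₀` to a word `w` in the arguments and to
degree `k` in the value. -/
def cxOp {n : ℕ} (w : Fin n → ℤ) (k : ℤ) : P.obj n ⊗ tens (fun i => M.cx.X (w i)) ⟶ M.cx.X k :=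
  M.semidirect.eval (fun i => twoTermIncl M.d.hom (w i)) ≫ twoTermProj M.d.hom k

theorem cxOp_one {n : ℕ} (w : Fin n → ℤ) :
    M.cxOp w 1 = P.obj n ◁ tensMap (fun i => twoTermIncl M.d.hom (w i)) ≫ M.action.ρ n :=
  (Category.assoc _ _ _).trans (congrArg _ (extendOp_fst M.base _))

theorem cxOp_zero {n : ℕ} (w : Fin n → ℤ) :
    M.cxOp w 0 = M.base.eval (fun i => twoTermIncl M.d.hom (w i) ≫ biprod.snd) :=
  Alg.eval_hom M.action.semidirectSnd _

theorem cxOp_const_zero (n : ℕ) : M.cxOp (fun _ : Fin n => 0) 0 = M.base.op n := by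
  have hincl : twoTermIncl M.d.hom 0 ≫ biprod.snd = 𝟙 M.base.X := biprod.inr_snd
  rw [cxOp_zero, hincl]
  exact M.base.eval_id n

theorem cxOp_act {n : ℕ} (σ : Equiv.Perm (Fin n)) (w : Fin n → ℤ) (k : ℤ) :
    P.act σ ▷ tens (fun i => M.cx.X (w i)) ≫ M.cxOp w k =
      P.obj n ◁ tensPerm σ (fun i => M.cx.X (w i)) ≫ M.cxOp (fun i => w (σ i)) k := by
  rw [cxOp, cxOp, reassoc_of% Alg.eval_act]

theorem cxOp_unit (w : Fin 1 → ℤ) :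
    P.unit ▷ tens (fun i => M.cx.X (w i)) ≫ M.cxOp w (w 0) =
      (λ_ _).hom ≫ (λ_ (M.cx.X (w 0))).hom := by
  rw [cxOp, reassoc_of% Alg.eval_unit, twoTermIncl_proj, Category.comp_id]

theorem whiskerLeft_dAt_cxOp {n : ℕ} (w : Fin n → ℤ) (i : Fin n) (k : ℤ) :
    P.obj n ◁ dAt M.cx w i ≫ M.cxOp (lower w i) k =
      M.semidirect.eval (Function.update (fun j => twoTermIncl M.d.hom (w j)) i
        (twoTermIncl M.d.hom (w i) ≫ biprod.fst ≫ M.d.hom ≫ biprod.inr)) ≫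
        twoTermProj M.d.hom k := by
  rw [cxOp, Alg.eval, Category.assoc, ← whiskerLeft_comp_assoc, dAt_tensMap_twoTermIncl, Alg.eval,
    Category.assoc]

theorem Peiffer.whiskerLeft_dAt_cxOp_one {M : PreXMod P} (hM : M.Peiffer) {n : ℕ} {w : Fin n → ℤ}
    {p q : Fin n} (hpq : p ≠ q) (hw : ∀ j, w j = 1 ↔ j = p ∨ j = q) :
    P.obj n ◁ dAt M.cx w q ≫ M.cxOp (lower w q) 1 = M.cxOp w 1 := by
  have hp : w p ≠ 0 := by rw [(hw p).2 (.inl rfl)]; exact one_ne_zero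
  have hq : w q ≠ 0 := by rw [(hw q).2 (.inr rfl)]; exact one_ne_zero
  rw [whiskerLeft_dAt_cxOp]
  exact hM.eval_update _ hpq (twoTermIncl_snd _ hp) (twoTermIncl_snd _ hq)
    fun j hjp hjq => twoTermIncl_fst _ fun h => ((hw j).1 h).elim hjp hjq

section Functoriality

variable {M} {N : PreXMod P} (φ : M ⟶ N)

theorem cxOp_map {n : ℕ} (w : Fin n → ℤ) (k : ℤ) :
    M.cxOp w k ≫ (cxMap φ).f k =
      P.obj n ◁ tensMap (fun i => (cxMap φ).f (w i)) ≫ N.cxOp w k := by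
  have hmap := Alg.eval_hom (semidirectMap φ) fun i => twoTermIncl M.d.hom (w i)
  rw [cxOp, cxOp, Category.assoc, twoTermProj_map, reassoc_of% Alg.whiskerLeft_tensMap_eval]
  simp only [twoTermMap_incl]
  exact (Category.assoc _ _ _).symm.trans (congrArg (· ≫ _) hmap)

theorem cxMap_id (M : PreXMod P) : cxMap (𝟙 M) = 𝟙 M.cx :=
  (twoTerm_inDegrees _).hom_ext rfl rfl

theorem cxMap_comp {L : PreXMod P} (ψ : L ⟶ M) : cxMap (ψ ≫ φ) = cxMap ψ ≫ cxMap φ :=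
  (twoTerm_inDegrees _).hom_ext rfl rfl

end Functoriality

variable [MonoidalPreadditive C]

theorem cxOp_incl {n : ℕ} {w : Fin n → ℤ} (hw : IsBinary w) {k : ℤ} (hk : ∑ i, w i = k)
    (hk1 : k ≤ 1) :
    M.cxOp w k ≫ twoTermIncl M.d.hom k =
      M.semidirect.eval (fun i => twoTermIncl M.d.hom (w i)) := by
  obtain rfl | rfl : k = 0 ∨ k = 1 := by
    have hnonneg : 0 ≤ ∑ i, w i := hw.sum_comp_nonneg id
    omega
  · obtain rfl := hw.eq_zero_of_sum_eq_zero hk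
    refine (Category.assoc _ _ _).trans ((eq_comp_snd_inr ?_).trans (Category.assoc _ _ _)).symm
    exact (M.cxOp_one _).trans (M.action.ρ_base n)
  · obtain ⟨i, hi⟩ := hw.exists_eq_one_iff_of_sum_eq_one hk
    refine (Category.assoc _ _ _).trans ((eq_comp_fst_inl ?_).trans (Category.assoc _ _ _)).symm
    refine (M.cxOp_zero w).trans (M.base.eval_eq_zero i (twoTermIncl_snd _ ?_))
    rw [(hi i).2 rfl]
    exact one_ne_zero

theorem cxOp_comp (a b m : ℕ) (w : Fin (a + m + b) → ℤ) (w' : Fin (a + 1 + b) → ℤ) (k : ℤ)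
    (h : ∑ i, w i = k) (hl : ∀ i, w (posL a m b i) = w' (posL a 1 b i))
    (hm : ∑ i, w (posM a m b i) = w' (posM a 1 b 0))
    (hr : ∀ i, w (posR a m b i) = w' (posR a 1 b i)) :
    P.comp a b m ▷ tens (fun i => M.cx.X (w i)) ≫ M.cxOp w k =
      (α_ _ _ _).hom ≫
        P.obj (a + 1 + b) ◁ plug a m b (F := fun i => M.cx.X (w i)) (G := fun i => M.cx.X (w' i))
          (fun i => eqToHom (congrArg M.cx.X (hl i)))
          (M.cxOp (fun i => w (posM a m b i)) _)
          (fun i => eqToHom (congrArg M.cx.X (hr i))) ≫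
        M.cxOp w' k := by
  refine (twoTerm_inDegrees M.d.hom).tensor_tens_hom_ext fun hw hk => ?_
  have hle : w' (posM a 1 b 0) ≤ 1 := by
    have hL := hw.sum_comp_nonneg (posL a m b)
    have hR := hw.sum_comp_nonneg (posR a m b)
    have hsum : ∑ i, w (posL a m b i) + ∑ i, w (posM a m b i) + ∑ i, w (posR a m b i) = k := by
      rw [← h, Fin.sum_univ_add, Fin.sum_univ_add]
    omega
  have heval := M.semidirect.eval_comp (F := fun i => M.cx.X (w i)) (G := fun i => M.cx.X (w' i))
    (g := fun i => twoTermIncl M.d.hom (w i)) (h := fun i => twoTermIncl M.d.hom (w' i))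
    (fun i => eqToHom_twoTermIncl M.d.hom (hl i)) (M.cxOp_incl (fun _ => hw _) hm hle)
    (fun i => eqToHom_twoTermIncl M.d.hom (hr i))
  simp only [cxOp, reassoc_of% heval]

theorem cxOp_d_one {n : ℕ} {w : Fin n → ℤ} {i : Fin n} (hi : ∀ j, w j = 1 ↔ j = i) :
    M.cxOp w 1 ≫ M.cx.d 1 0 = P.obj n ◁ dAt M.cx w i ≫ M.cxOp (lower w i) 0 := by
  let incl (j : Fin n) : M.cx.X (w j) ⟶ M.semidirect.X := twoTermIncl M.d.hom (w j)
  let incl' := Function.update incl i (incl i ≫ biprod.fst ≫ M.d.hom ≫ biprod.inr)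
  have hsnd : incl i ≫ biprod.snd = 0 :=
    twoTermIncl_snd _ (by rw [(hi i).2 rfl]; exact one_ne_zero)
  have hfst {j : Fin n} (hj : j ≠ i) : incl j ≫ biprod.fst = 0 :=
    twoTermIncl_fst _ fun h => hj ((hi j).1 h)
  have htarget (j : Fin n) : incl j ≫ M.target.hom = incl' j ≫ biprod.snd := by
    rw [sub_eq_iff_eq_add.1 M.fst_d_eq_target_sub_snd.symm]
    by_cases hj : j = i
    · subst hj
      simp [incl', hsnd, Action.semidirectSnd]
    · simp [incl', hj, reassoc_of% hfst hj, Action.semidirectSnd]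
  have heval : M.semidirect.eval incl ≫ biprod.fst ≫ M.d.hom =
      M.semidirect.eval incl' ≫ biprod.snd :=
    calc M.semidirect.eval incl ≫ biprod.fst ≫ M.d.hom
      _ = M.base.eval (fun j => incl j ≫ M.target.hom) -
            M.base.eval (fun j => incl j ≫ M.action.semidirectSnd.hom) := by
          rw [fst_d_eq_target_sub_snd, Preadditive.comp_sub, Alg.eval_hom, Alg.eval_hom]
      _ = M.base.eval (fun j => incl' j ≫ M.action.semidirectSnd.hom) := by
          rw [M.base.eval_eq_zero (g := fun j => incl j ≫ M.action.semidirectSnd.hom) i hsnd,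
            sub_zero, funext htarget]
          rfl
      _ = M.semidirect.eval incl' ≫ biprod.snd := (Alg.eval_hom M.action.semidirectSnd _).symm
  rw [whiskerLeft_dAt_cxOp]
  exact (Category.assoc _ _ _).trans heval

variable {M}

theorem Peiffer.cxOp_d (hM : M.Peiffer) {n : ℕ} (w : Fin n → ℤ) (k : ℤ) (h : ∑ i, w i = k) :
    M.cxOp w k ≫ M.cx.d k (k - 1) =
      ∑ i, (∑ j ∈ Finset.Iio i, w j).negOnePow •
        (P.obj n ◁ dAt M.cx w i ≫ M.cxOp (lower w i) (k - 1)) := by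
  refine (twoTerm_inDegrees M.d.hom).tensor_tens_hom_ext fun hw hk => ?_
  have hzero (i : Fin n) (hi : w i ≠ 1) : (∑ j ∈ Finset.Iio i, w j).negOnePow •
      (P.obj n ◁ dAt M.cx w i ≫ M.cxOp (lower w i) (k - 1)) = 0 := by
    rw [dAt_twoTerm_eq_zero M.d.hom hi, MonoidalPreadditive.whiskerLeft_zero, zero_comp, smul_zero]
  obtain rfl | rfl : k = 1 ∨ k = 2 := by omega
  · obtain ⟨i, hi⟩ := hw.exists_eq_one_iff_of_sum_eq_one h
    have hsign : ∑ j ∈ Finset.Iio i, w j = 0 := Finset.sum_eq_zero fun j hj =>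
      (hw j).resolve_right fun h => (Finset.mem_Iio.1 hj).ne ((hi j).1 h)
    rw [Finset.sum_eq_single i (fun j _ hj => hzero j fun h => hj ((hi j).1 h)) (by simp), hsign,
      Int.negOnePow_zero, one_smul]
    exact M.cxOp_d_one hi
  · obtain ⟨p, q, hlt, hpq⟩ := hw.exists_eq_one_iff_of_sum_eq_two h
    have hsign_p : ∑ j ∈ Finset.Iio p, w j = 0 := Finset.sum_eq_zero fun j hj =>
      (hw j).resolve_right fun h => ((hpq j).1 h).elim (Finset.mem_Iio.1 hj).ne
        ((Finset.mem_Iio.1 hj).trans hlt).ne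
    have hsign_q : ∑ j ∈ Finset.Iio q, w j = 1 := by
      rw [Finset.sum_eq_single_of_mem p (Finset.mem_Iio.2 hlt) fun j hj hjp =>
        (hw j).resolve_right fun h => ((hpq j).1 h).elim hjp (Finset.mem_Iio.1 hj).ne]
      exact (hpq p).2 (.inl rfl)
    have hcancel : P.obj n ◁ dAt M.cx w p ≫ M.cxOp (lower w p) (2 - 1) =
        P.obj n ◁ dAt M.cx w q ≫ M.cxOp (lower w q) (2 - 1) :=
      (hM.whiskerLeft_dAt_cxOp_one hlt.ne' fun j => (hpq j).trans or_comm).trans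
        (hM.whiskerLeft_dAt_cxOp_one hlt.ne hpq).symm
    rw [Finset.sum_eq_add p q hlt.ne
      (fun j _ hj => hzero j fun h => ((hpq j).1 h).elim hj.1 hj.2) (by simp) (by simp),
      hsign_p, hsign_q, Int.negOnePow_zero, one_smul, Int.negOnePow_one, Units.neg_smul, one_smul,
      hcancel, add_neg_cancel, twoTerm_d_eq_zero M.d.hom (by omega), comp_zero]

/-- The differential graded algebra structure on the complex of a crossed module. -/
def Peiffer.dgStr (hM : M.Peiffer) : DGStr P M.cx where
  op w k _ := M.cxOp w k
  op_d := hM.cxOp_d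
  op_act σ w k h := by
    refine (twoTerm_inDegrees M.d.hom).tensor_tens_hom_ext fun hw hk => ?_
    rw [hw.koszulSign_eq_one (by omega), one_smul, cxOp_act]
  op_unit := M.cxOp_unit
  op_comp a b m w w' k h _ := M.cxOp_comp a b m w w' k h

theorem Peiffer.isInduced_dgStr (hM : M.Peiffer) : M.IsInduced hM.dgStr where
  degree_zero := M.cxOp_const_zero
  degree_one w _ := M.cxOp_one w
  degree_ge_two _ k _ hk := (twoTerm_inDegrees M.d.hom k (by omega) (by omega)).eq_of_tgt _ _

theorem IsInduced.unique {s t : DGStr P M.cx} (hs : M.IsInduced s) (ht : M.IsInduced t) :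
    s = t := by
  apply DGStr.ext
  funext n w k h
  refine (twoTerm_inDegrees M.d.hom).tensor_tens_hom_ext fun hw hk => ?_
  rcases hk with rfl | rfl
  · obtain rfl := hw.eq_zero_of_sum_eq_zero h
    exact (hs.degree_zero n).trans (ht.degree_zero n).symm
  · rw [hs.degree_one, ht.degree_one]

/-- The functor from crossed modules to differential graded algebras in degrees `0` and `1`. -/
def toDGFunctor (P : SymmOperad C) : XMod P ⥤ DGAlgLEOne P where
  obj M := M.obj.toDG M.property.dgStr
  map φ := ⟨⟨cxMap φ.hom, fun w k _ => cxOp_map φ.hom w k⟩⟩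
  map_id M := ObjectProperty.hom_ext _ (DGAlg.Hom.ext (cxMap_id M.obj))
  map_comp φ ψ := ObjectProperty.hom_ext _ (DGAlg.Hom.ext (cxMap_comp ψ.hom φ.hom))

end PreXMod

end

end OpdX

theorem mainTheorem9_general {C : Type u} [Category.{v} C] [Abelian C] [MonoidalCategory C]
    [SymmetricCategory C] [MonoidalPreadditive C] (P : OpdX.SymmOperad C) :
    ∃ s : ∀ M : OpdX.XMod P, OpdX.DGStr P M.obj.cx,
      (∀ M : OpdX.XMod P, M.obj.IsInduced (s M)) ∧
      (∀ (M : OpdX.XMod P) (t : OpdX.DGStr P M.obj.cx), M.obj.IsInduced t → t = s M) ∧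
      ∃ (Φ : OpdX.XMod P ⥤ OpdX.DGAlgLEOne P) (hΦ : ∀ M, Φ.obj M = M.obj.toDG (s M)),
        ∀ (M N : OpdX.XMod P) (φ : M ⟶ N),
          (Φ.map φ).hom.hom =
            eqToHom (congrArg (fun A => A.obj.cx) (hΦ M)) ≫ OpdX.PreXMod.cxMap φ.hom ≫
              eqToHom (congrArg (fun A => A.obj.cx) (hΦ N).symm) :=
  ⟨fun M => M.property.dgStr, fun M => M.property.isInduced_dgStr,
    fun M _ ht => ht.unique M.property.isInduced_dgStr, OpdX.PreXMod.toDGFunctor P, fun _ => rfl,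
    fun _ _ _ => ((Category.id_comp _).trans (Category.comp_id _)).symm⟩

theorem mainTheorem9 {C : Type u} [Category.{v} C] [Abelian C] [HasLimits C] [HasColimits C]
    [MonoidalCategory C] [SymmetricCategory C] [MonoidalClosed C]
    (P : OpdX.SymmOperad C) (hP : P.IsReduced) :
    ∃ s : ∀ M : OpdX.XMod P, OpdX.DGStr P M.obj.cx,
      (∀ M : OpdX.XMod P, M.obj.IsInduced (s M)) ∧
      (∀ (M : OpdX.XMod P) (t : OpdX.DGStr P M.obj.cx), M.obj.IsInduced t → t = s M) ∧
      ∃ (Φ : OpdX.XMod P ⥤ OpdX.DGAlgLEOne P) (hΦ : ∀ M, Φ.obj M = M.obj.toDG (s M)),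
        ∀ (M N : OpdX.XMod P) (φ : M ⟶ N),
          (Φ.map φ).hom.hom =
            eqToHom (congrArg (fun A => A.obj.cx) (hΦ M)) ≫ OpdX.PreXMod.cxMap φ.hom ≫
              eqToHom (congrArg (fun A => A.obj.cx) (hΦ N).symm) := by
  have : MonoidalPreadditive C := OpdX.monoidalPreadditive_of_monoidalClosed
  exact mainTheorem9_general P
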